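/- Let $R=(E,(\rho_i)_{i\in I})$ be a relational structure, where $E$ and $I$ are arbitrary sets and $\rho_i$ is an $m_i$-ary relation on $E$; in particular $R$ may have infinitely many isomorphism types of $n$-element substructures. For $A\subseteq E$ let $R_{\restriction A}$ be the substructure induced on $A$, and let the age $\mathcal A(R)$ be the collection of the structures $R_{\restriction F}$ with $F\subseteq E$ finite, isomorphic structures being identified. Let $[E]^m$ be the set of $m$-element subsets of $E$. A map $f:[E]^m\to\mathbb C$ ($m\ge 0$) is $R$-invariant if $f(P)=f(P')$ whenever $R_{\restriction P}$ and $R_{\restriction P'}$ are isomorphic. The age algebra $\mathbb C.\mathcal A(R)$ is the graded $\mathbb C$-algebra $\bigoplus_{m\ge 0}\{f:[E]^m\to\mathbb C \mid f \text{ is } R\text{-invariant}\}$, where the product of $f:[E]^m\to\mathbb C$ and $g:[E]^n\to\mathbb C$ is given by $(fg)(Q)=\sum_{P\in[Q]^m}f(P)\,g(Q\setminus P)$ for $Q\in[E]^{m+n}$. The kernel of $R$ is $K(R)=\{x\in E:\mathcal A(R_{\restriction E\setminus\{x\}})\neq\mathcal A(R)\}$. Then $\mathbb C.\mathcal A(R)$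 is an integral domain if and only if $K(R)=\emptyset$. Moreover, $K(R)=\emptyset$ if and only if $R$ is age-inexhaustible, that is, any two members of $\mathcal A(R)$ embed into a third member of $\mathcal A(R)$ with disjoint images. -/

import Mathlib

/-- The maps from the finite subsets of `E` (including `∅`) to `K`. -/
def FinsetMap (K E : Type*) : Type _ := Finset E → K

namespace FinsetMap

variable {K E : Type*} [Field K]

instance : AddCommGroup (FinsetMap K E) := inferInstanceAs (AddCommGroup (Finset E → K))

instance : Module K (FinsetMap K E) := inferInstanceAs (Module K (Finset E → K))

instance : CoeFun (FinsetMap K E) (fun _ => Finset E → K) := ⟨fun f => f⟩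

@[ext] theorem ext {K E : Type*} {f g : FinsetMap K E} (h : ∀ Q, f Q = g Q) : f = g := funext h

@[simp] theorem zero_apply (Q : Finset E) : (0 : FinsetMap K E) Q = 0 := rfl

@[simp] theorem add_apply (f g : FinsetMap K E) (Q : Finset E) : (f + g) Q = f Q + g Q := rfl

@[simp] theorem smul_apply (c : K) (f : FinsetMap K E) (Q : Finset E) :
    (c • f) Q = c * f Q := rfl

open Classical in
/-- The unit: the map with value `1` on `∅` and `0` elsewhere. -/
noncomputable instance : One (FinsetMap K E) := ⟨fun Q => if Q = ∅ then 1 else 0⟩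

open Classical in
/-- The product `(f g)(Q) = ∑_{P ⊆ Q} f(P) g(Q \ P)`. -/
noncomputable instance : Mul (FinsetMap K E) := ⟨fun f g Q => ∑ P ∈ Q.powerset, f P * g (Q \ P)⟩

open Classical in
theorem one_apply (Q : Finset E) : (1 : FinsetMap K E) Q = if Q = ∅ then 1 else 0 := rfl

open Classical in
theorem mul_apply (f g : FinsetMap K E) (Q : Finset E) :
    (f * g) Q = ∑ P ∈ Q.powerset, f P * g (Q \ P) := rfl

protected theorem mul_comm (f g : FinsetMap K E) : f * g = g * f := by
  classical
  ext Q
  rw [mul_apply, mul_apply]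
  refine Finset.sum_nbij' (fun P => Q \ P) (fun P => Q \ P) ?_ ?_ ?_ ?_ ?_
  · intro P _; simp
  · intro P _; simp
  · intro P hP; simpa using Finset.mem_powerset.1 hP
  · intro P hP; simpa using Finset.mem_powerset.1 hP
  · intro P hP
    have h : Q \ (Q \ P) = P := by simpa using Finset.mem_powerset.1 hP
    simp only [h]
    exact mul_comm _ _

protected theorem one_mul (f : FinsetMap K E) : 1 * f = f := by
  classical
  ext Q
  rw [mul_apply, Finset.sum_eq_single ∅]
  · simp [one_apply]
  · intro P _ hP; simp [one_apply, hP]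
  · intro h; simp at h

protected theorem mul_assoc (f g h : FinsetMap K E) : f * g * h = f * (g * h) := by
  classical
  ext Q
  simp only [mul_apply, Finset.sum_mul, Finset.mul_sum]
  rw [Finset.sum_sigma', Finset.sum_sigma']
  refine Finset.sum_nbij' (fun x => ⟨x.2, x.1 \ x.2⟩) (fun x => ⟨x.1 ∪ x.2, x.1⟩) ?_ ?_ ?_ ?_ ?_
  · rintro ⟨P, S⟩ hx
    simp only [Finset.mem_sigma, Finset.mem_powerset] at hx ⊢
    exact ⟨hx.2.trans hx.1, Finset.sdiff_subset_sdiff hx.1 subset_rfl⟩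
  · rintro ⟨P, S⟩ hx
    simp only [Finset.mem_sigma, Finset.mem_powerset] at hx ⊢
    exact ⟨Finset.union_subset hx.1 (hx.2.trans Finset.sdiff_subset), Finset.subset_union_left⟩
  · rintro ⟨P, S⟩ hx
    simp only [Finset.mem_sigma, Finset.mem_powerset] at hx
    simp [Finset.union_eq_right.2 hx.2]
  · rintro ⟨P, S⟩ hx
    simp only [Finset.mem_sigma, Finset.mem_powerset] at hx
    have hd : Disjoint S P := Finset.disjoint_of_subset_left hx.2 Finset.sdiff_disjoint
    have : (P ∪ S) \ P = S := by
      rw [Finset.union_sdiff_left]; exact Finset.sdiff_eq_self_of_disjoint hd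
    simp [this]
  · rintro ⟨P, S⟩ hx
    simp only [Finset.mem_sigma, Finset.mem_powerset] at hx
    have : (Q \ S) \ (P \ S) = Q \ P := by
      ext a
      have := @hx.2 a
      simp only [Finset.mem_sdiff]
      tauto
    simp only [this]
    exact mul_assoc _ _ _

protected theorem mul_add (f g h : FinsetMap K E) : f * (g + h) = f * g + f * h := by
  ext Q
  simp only [mul_apply, add_apply, mul_add, Finset.sum_add_distrib]

noncomputable instance : CommRing (FinsetMap K E) :=
  { (inferInstance : AddCommGroup (FinsetMap K E)) with
    mul := (· * ·)
    one := 1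
    mul_comm := FinsetMap.mul_comm
    mul_assoc := FinsetMap.mul_assoc
    one_mul := FinsetMap.one_mul
    mul_one := fun f => by rw [FinsetMap.mul_comm, FinsetMap.one_mul]
    left_distrib := FinsetMap.mul_add
    right_distrib := fun f g h => by
      rw [FinsetMap.mul_comm, FinsetMap.mul_add, FinsetMap.mul_comm h, FinsetMap.mul_comm h]
    zero_mul := fun f => by
      ext Q; simp only [mul_apply, zero_apply, zero_mul, Finset.sum_const_zero]
    mul_zero := fun f => by
      ext Q; simp only [mul_apply, zero_apply, mul_zero, Finset.sum_const_zero] }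

noncomputable instance : Algebra K (FinsetMap K E) :=
  Algebra.ofModule
    (fun c f g => by
      ext Q; simp only [mul_apply, smul_apply, Finset.mul_sum, mul_assoc])
    (fun c f g => by
      ext Q; simp only [mul_apply, smul_apply, Finset.mul_sum]
      exact Finset.sum_congr rfl fun P _ => by ring)

end FinsetMap

namespace FirstOrder.Language

variable (L : Language) [L.IsRelational] (E : Type*) [L.Structure E]

/-- The substructure induced on an arbitrary subset `A` of the domain (the language has only
relation symbols). -/
def restrict {E : Type*} [L.Structure E] (A : Set E) : L.Substructure E where
  carrier := A
  fun_mem f := isEmptyElim f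

/-- The restrictions to the finite subsets `P` and `P'` are isomorphic. -/
def RestrictIso {E : Type*} [L.Structure E] (P P' : Finset E) : Prop :=
  Nonempty (L.restrict (P : Set E) ≃[L] L.restrict (P' : Set E))

/-- The kernel: the elements whose removal changes the age. -/
def kernel : Set E := {x | L.age (L.restrict ({x}ᶜ : Set E)) ≠ L.age E}

/-- The age is inexhaustible: any two of its members embed into a third one with disjoint
images. -/
def AgeInexhaustible : Prop :=
  ∀ A ∈ L.age E, ∀ B ∈ L.age E, ∃ C ∈ L.age E, ∃ (f : A ↪[L] C) (g : B ↪[L] C),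
    Disjoint (Set.range f) (Set.range g)

/-- A map on finite subsets is invariant if it takes the same value on subsets with isomorphic
restrictions. -/
def IsInvariant {K : Type*} {E : Type*} [L.Structure E] (f : FinsetMap K E) : Prop :=
  ∀ P P' : Finset E, L.RestrictIso P P' → f P = f P'

variable {L} in
theorem RestrictIso.card_eq {E : Type*} [L.Structure E] {P P' : Finset E}
    (h : L.RestrictIso P P') : P.card = P'.card := by
  obtain ⟨φ⟩ := h
  exact Finset.card_eq_of_equiv φ.toEquiv

open Classical in
variable {L} in
/-- An isomorphism of finite restrictions matches the subsets of `P` with those of `P'`. -/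
theorem RestrictIso.exists_map {E : Type*} [L.Structure E] {P P' : Finset E}
    (h : L.RestrictIso P P') : ∃ φ ψ : E → E,
      (∀ x ∈ P, φ x ∈ P' ∧ ψ (φ x) = x) ∧ (∀ y ∈ P', ψ y ∈ P ∧ φ (ψ y) = y) ∧
      ∀ S ⊆ P, L.RestrictIso S (S.image φ) := by
  obtain ⟨e⟩ := h
  let φ : E → E := fun x => if hx : x ∈ P then (e ⟨x, hx⟩ : E) else x
  let ψ : E → E := fun x => if hx : x ∈ P' then (e.symm ⟨x, hx⟩ : E) else x
  have hφ : ∀ (x : E) (hx : x ∈ P), φ x = (e ⟨x, hx⟩ : E) := fun x hx => dif_pos hx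
  have hψ : ∀ (x : E) (hx : x ∈ P'), ψ x = (e.symm ⟨x, hx⟩ : E) := fun x hx => dif_pos hx
  have h1 : ∀ x ∈ P, φ x ∈ P' ∧ ψ (φ x) = x := by
    intro x hx
    have hm : φ x ∈ P' := by rw [hφ x hx]; exact (e ⟨x, hx⟩).2
    refine ⟨hm, ?_⟩
    rw [hψ _ hm]
    have : (⟨φ x, hm⟩ : L.restrict (P' : Set E)) = e ⟨x, hx⟩ := Subtype.ext (hφ x hx)
    rw [this, e.symm_apply_apply]
  have h2 : ∀ y ∈ P', ψ y ∈ P ∧ φ (ψ y) = y := by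
    intro x hx
    have hm : ψ x ∈ P := by rw [hψ x hx]; exact (e.symm ⟨x, hx⟩).2
    refine ⟨hm, ?_⟩
    rw [hφ _ hm]
    have : (⟨ψ x, hm⟩ : L.restrict (P : Set E)) = e.symm ⟨x, hx⟩ := Subtype.ext (hψ x hx)
    rw [this, e.apply_symm_apply]
  refine ⟨φ, ψ, h1, h2, fun S hS => ⟨⟨⟨fun x => ⟨φ x, Finset.mem_image_of_mem φ x.2⟩,
    fun y => ⟨ψ y, ?_⟩, ?_, ?_⟩, fun f => isEmptyElim f, ?_⟩⟩⟩
  · obtain ⟨x, hx, hxy⟩ := Finset.mem_image.1 y.2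
    rw [← hxy, (h1 x (hS hx)).2]
    exact hx
  · intro x
    exact Subtype.ext (h1 x (hS x.2)).2
  · intro y
    obtain ⟨x, hx, hxy⟩ := Finset.mem_image.1 y.2
    refine Subtype.ext (h2 y ?_).2
    rw [← hxy]
    exact (h1 x (hS hx)).1
  · intro n r x
    have key := e.map_rel r (fun i => ⟨x i, hS (x i).2⟩)
    have hx : (fun i => φ (x i)) = fun i => (e ⟨x i, hS (x i).2⟩ : E) :=
      funext fun i => hφ _ _
    change Structure.RelMap r (fun i => φ (x i)) ↔ Structure.RelMap r (fun i => (x i : E))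
    rw [hx]
    exact key

theorem IsInvariant.mul {K : Type*} [Field K] {E : Type*} [L.Structure E] {f g : FinsetMap K E}
    (hf : L.IsInvariant f) (hg : L.IsInvariant g) : L.IsInvariant (f * g) := by
  classical
  intro P P' h
  obtain ⟨φ, ψ, h1, h2, h3⟩ := h.exists_map
  have hsub : ∀ S ⊆ P, S.image φ ⊆ P' := fun S hS =>
    Finset.image_subset_iff.2 fun x hx => (h1 x (hS hx)).1
  have hsub' : ∀ S ⊆ P', S.image ψ ⊆ P := fun S hS =>
    Finset.image_subset_iff.2 fun x hx => (h2 x (hS hx)).1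
  have hinv : ∀ S ⊆ P, (S.image φ).image ψ = S := fun S hS => by
    rw [Finset.image_image]
    conv_rhs => rw [← Finset.image_id (s := S)]
    exact Finset.image_congr fun x hx => (h1 x (hS hx)).2
  have hinv' : ∀ S ⊆ P', (S.image ψ).image φ = S := fun S hS => by
    rw [Finset.image_image]
    conv_rhs => rw [← Finset.image_id (s := S)]
    exact Finset.image_congr fun x hx => (h2 x (hS hx)).2
  have hPP : P.image φ = P' :=
    (hsub P subset_rfl).antisymm fun y hy =>
      Finset.mem_image.2 ⟨ψ y, (h2 y hy).1, (h2 y hy).2⟩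
  rw [FinsetMap.mul_apply, FinsetMap.mul_apply]
  refine Finset.sum_nbij' (fun S => S.image φ) (fun S => S.image ψ) ?_ ?_ ?_ ?_ ?_
  · intro S hS
    exact Finset.mem_powerset.2 (hsub S (Finset.mem_powerset.1 hS))
  · intro S hS
    exact Finset.mem_powerset.2 (hsub' S (Finset.mem_powerset.1 hS))
  · intro S hS
    exact hinv S (Finset.mem_powerset.1 hS)
  · intro S hS
    exact hinv' S (Finset.mem_powerset.1 hS)
  · intro S hS
    have hS' := Finset.mem_powerset.1 hS
    have hinj : Set.InjOn φ (P : Set E) := fun x hx y hy hxy => by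
      rw [← (h1 x hx).2, hxy, (h1 y hy).2]
    have hd : P' \ S.image φ = (P \ S).image φ := by
      rw [Finset.image_sdiff_of_injOn hinj hS', hPP]
    simp only [hd]
    rw [hf _ _ (h3 S hS'), hg _ _ (h3 (P \ S) Finset.sdiff_subset)]

/-- The age algebra over `K`: the finite sums of invariant maps `[E]^m → K`, `m = 0, 1, 2, …`, a
map on `[E]^m` being extended by `0` to all finite subsets. -/
noncomputable def ageAlgebra (K : Type*) [Field K] : Subalgebra K (FinsetMap K E) where
  carrier := {f | L.IsInvariant f ∧ ∃ N : ℕ, ∀ P : Finset E, N ≤ P.card → f P = 0}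
  mul_mem' := by
    classical
    rintro f g ⟨hf, M, hM⟩ ⟨hg, N, hN⟩
    refine ⟨IsInvariant.mul L hf hg, M + N, fun Q hQ => ?_⟩
    rw [FinsetMap.mul_apply]
    refine Finset.sum_eq_zero fun P hP => ?_
    have h := Finset.card_sdiff_add_card_eq_card (Finset.mem_powerset.1 hP)
    by_cases hPM : M ≤ P.card
    · rw [hM P hPM, zero_mul]
    · rw [hN (Q \ P) (by omega), mul_zero]
  add_mem' := by
    rintro f g ⟨hf, M, hM⟩ ⟨hg, N, hN⟩
    refine ⟨fun P P' h => ?_, max M N, fun P hP => ?_⟩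
    · rw [FinsetMap.add_apply, FinsetMap.add_apply, hf P P' h, hg P P' h]
    · rw [FinsetMap.add_apply, hM P (le_trans (le_max_left _ _) hP),
        hN P (le_trans (le_max_right _ _) hP), add_zero]
  algebraMap_mem' := by
    intro c
    rw [Algebra.algebraMap_eq_smul_one]
    refine ⟨fun P P' h => ?_, 1, fun P hP => ?_⟩
    · simp only [FinsetMap.smul_apply, FinsetMap.one_apply, ← Finset.card_eq_zero]
      rw [h.card_eq]
    · have : P ≠ ∅ := by rintro rfl; simp at hP
      simp [FinsetMap.one_apply, this]

/-- The age algebra is the linear span of the homogeneous invariant maps. -/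
theorem ageAlgebra_eq_span (K : Type*) [Field K] :
    Subalgebra.toSubmodule (L.ageAlgebra E K) =
      Submodule.span K {f | ∃ m : ℕ, L.IsInvariant f ∧ ∀ P : Finset E, P.card ≠ m → f P = 0} := by
  classical
  apply le_antisymm
  · rintro f ⟨hf, N, hN⟩
    have hsum : f = ∑ m ∈ Finset.range N,
        (show FinsetMap K E from fun P => if P.card = m then f P else 0) := by
      ext P
      have happ : ∀ (s : Finset ℕ) (F : ℕ → FinsetMap K E),
          (∑ m ∈ s, F m) P = ∑ m ∈ s, F m P := fun s F => Finset.sum_apply P s F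
      rw [happ]
      change f P = ∑ m ∈ Finset.range N, if P.card = m then f P else 0
      rw [Finset.sum_ite_eq]
      split_ifs with h
      · rfl
      · exact hN P (by simpa using h)
    rw [hsum]
    refine Submodule.sum_mem _ fun m _ => Submodule.subset_span ⟨m, fun P P' h => ?_, ?_⟩
    · change (if P.card = m then f P else 0) = if P'.card = m then f P' else 0
      rw [h.card_eq, hf P P' h]
    · intro P hP
      exact if_neg hP
  · rw [Submodule.span_le]
    rintro f ⟨m, hf, hm⟩
    exact ⟨hf, m + 1, fun P hP => hm P (by omega)⟩

end FirstOrder.Language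

/-! If the kernel is empty, every finite restriction has a copy off any given finite set
(`exists_copies_not_met`). Given nonzero `f` and `g`, choose finite `A`, `B` on which they do not
vanish, put `D = A ∪ B`, and let `e t` copy `D` off `t`. A word of nonempty subsets of `D` is
realized by a union of copies of its letters, each copy being generic, along an ultrafilter, over
the earlier ones. Colour a finite set by the quadrants of its values under `f` and `g`, with zero as
a separate colour; every word then has a generic colour. Bounded degree bounds the words of nonzero
colour, so the longest ones for `f` and for `g` form finite sets `s` and `s'`.

Some word `w` is a shuffle of exactly one pair from `s` and `s'` (`Shuffle.exists_unique_pair`). Let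
`Q` be a generic realization of `w`. A nonzero term `f P * g (Q \ P)` yields two words no longer
than the two maximal lengths. As these lengths add up to that of `w`, no letter is cut, and the two
words are the unique pair. Hence all nonzero terms are products from two fixed quadrants, and they
cannot cancel (`Complex.sum_ne_zero_of_quadrant`).

Conversely, if every copy of some finite `F` contains `x`, the indicator of the copies of `F` has
square zero. -/

/-! ### Shuffles of words. -/

/-- `Shuffle u v w`: the word `w` is a shuffle of the words `u` and `v`. -/
inductive Shuffle {α : Type*} : List α → List α → List α → Prop
  | nil : Shuffle [] [] []
  | left (x : α) {u v w : List α} : Shuffle u v w → Shuffle (x :: u) v (x :: w)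
  | right (x : α) {u v w : List α} : Shuffle u v w → Shuffle u (x :: v) (x :: w)

namespace Shuffle

variable {α : Type*}

theorem symm {u v w : List α} (h : Shuffle u v w) : Shuffle v u w := by
  induction h with
  | nil => exact nil
  | left x _ ih => exact ih.right x
  | right x _ ih => exact ih.left x

theorem append (u v : List α) : Shuffle u v (u ++ v) := by
  induction u with
  | nil =>
    induction v with
    | nil => exact nil
    | cons y v ih => exact ih.right y
  | cons x u ih => exact ih.left x

theorem perm {u v w : List α} (h : Shuffle u v w) : w.Perm (u ++ v) := by
  induction h with
  | nil => exact List.Perm.refl _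
  | left x _ ih => exact ih.cons x
  | right x _ ih => exact (ih.cons x).trans List.perm_middle.symm

theorem length_eq {u v w : List α} (h : Shuffle u v w) : w.length = u.length + v.length := by
  rw [h.perm.length_eq, List.length_append]

theorem finite_setOf (u v : List α) : {w | Shuffle u v w}.Finite := by
  classical
  refine (List.finite_toSet (u ++ v).permutations).subset fun w hw => ?_
  exact List.mem_permutations.2 hw.perm

/-- Increasing one of two words lexicographically increases their shuffles. -/
theorem exists_lt [LinearOrder α] {u v w : List α} (h : Shuffle u v w) :
    ∀ {u' : List α}, u.length = u'.length → u < u' → ∃ w', Shuffle u' v w' ∧ w < w' := by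
  induction h with
  | nil =>
    intro u' hl hlt
    rw [List.length_eq_zero_iff.1 hl.symm] at hlt
    exact absurd hlt (lt_irrefl _)
  | @left x u v w _ ih =>
    intro u' hl hlt
    cases u' with
    | nil => simp at hl
    | cons x' u' =>
      rcases List.cons_lt_cons_iff.1 hlt with hx | ⟨rfl, hu⟩
      -- The comparison is settled at this letter, so any shuffle of the tails will do.
      · exact ⟨_, (append u' v).left x', List.cons_lt_cons_iff.2 (Or.inl hx)⟩
      · obtain ⟨w', hw', hlt'⟩ := ih (by simpa using hl) hu
        exact ⟨_, hw'.left x, List.cons_lt_cons_iff.2 (Or.inr ⟨rfl, hlt'⟩)⟩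
  | @right x u v w _ ih =>
    intro u' hl hlt
    obtain ⟨w', hw', hlt'⟩ := ih hl hlt
    exact ⟨_, hw'.right x, List.cons_lt_cons_iff.2 (Or.inr ⟨rfl, hlt'⟩)⟩

/-- Two finite nonempty sets of words, each of constant length, have a shuffle that comes from
only one pair of words. This is the reason for the integrity of shuffle algebras. -/
theorem exists_unique_pair {s t : Set (List α)} (hs : s.Finite) (ht : t.Finite)
    (hs0 : s.Nonempty) (ht0 : t.Nonempty) {p q : ℕ} (hp : ∀ u ∈ s, u.length = p)
    (hq : ∀ v ∈ t, v.length = q) :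
    ∃ u ∈ s, ∃ v ∈ t, ∃ w, Shuffle u v w ∧
      ∀ u' ∈ s, ∀ v' ∈ t, Shuffle u' v' w → u' = u ∧ v' = v := by
  classical
  let _ : LinearOrder α := linearOrderOfSTO WellOrderingRel
  obtain ⟨u, hu, hu'⟩ := Set.exists_max_image s id hs hs0
  obtain ⟨v, hv, hv'⟩ := Set.exists_max_image t id ht ht0
  obtain ⟨w, hw, hw'⟩ := Set.exists_max_image {w | Shuffle u v w} id (finite_setOf u v)
    ⟨_, append u v⟩
  -- Raise `u'` to the maximum `u`, then `v'` to the maximum `v`: each actual change strictly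
  -- increases the shuffle, so the largest shuffle `w` of the two maxima has no other origin.
  have key : ∀ u' ∈ s, ∀ v' ∈ t, ∀ w', Shuffle u' v' w' →
      ∃ w'', Shuffle u v w'' ∧ w' ≤ w'' ∧ (¬(u' = u ∧ v' = v) → w' < w'') := by
    intro u' h1 v' h2 w' h
    obtain ⟨a, ha, haw, hau⟩ : ∃ a, Shuffle u v' a ∧ w' ≤ a ∧ (u' ≠ u → w' < a) := by
      by_cases he : u' = u
      · exact ⟨w', he ▸ h, le_rfl, fun hn => absurd he hn⟩
      · obtain ⟨a, ha, hlt⟩ := h.exists_lt ((hp _ h1).trans (hp _ hu).symm)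
          (lt_of_le_of_ne (hu' _ h1) he)
        exact ⟨a, ha, hlt.le, fun _ => hlt⟩
    obtain ⟨b, hb, hab, hbv⟩ : ∃ b, Shuffle u v b ∧ a ≤ b ∧ (v' ≠ v → a < b) := by
      by_cases he : v' = v
      · exact ⟨a, he ▸ ha, le_rfl, fun hn => absurd he hn⟩
      · obtain ⟨b, hb, hlt⟩ := ha.symm.exists_lt ((hq _ h2).trans (hq _ hv).symm)
          (lt_of_le_of_ne (hv' _ h2) he)
        exact ⟨b, hb.symm, hlt.le, fun _ => hlt⟩
    refine ⟨b, hb, haw.trans hab, fun hn => ?_⟩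
    by_cases he : u' = u
    · exact haw.trans_lt (hbv fun h => hn ⟨he, h⟩)
    · exact (hau he).trans_le hab
  refine ⟨u, hu, v, hv, w, hw, fun u' h1 v' h2 h => ?_⟩
  by_contra hn
  obtain ⟨w'', h3, -, h4⟩ := key u' h1 v' h2 w h
  exact absurd (hw' _ h3) (not_le.2 (h4 hn))

end Shuffle

/-! ### Words of finite sets, and cutting their letters. -/

/-- `LetterSplit w u v`: every letter of `w` contains a letter of `u`, a letter of `v`, or both. -/
inductive LetterSplit {E : Type*} : List (Finset E) → List (Finset E) → List (Finset E) → Prop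
  | nil : LetterSplit [] [] []
  | left {T : Finset E} {w u v : List (Finset E)} :
      LetterSplit w u v → LetterSplit (T :: w) (T :: u) v
  | right {T : Finset E} {w u v : List (Finset E)} :
      LetterSplit w u v → LetterSplit (T :: w) u (T :: v)
  | both {T S S' : Finset E} {w u v : List (Finset E)} : S.Nonempty → S'.Nonempty → S ⊆ T →
      S' ⊆ T → LetterSplit w u v → LetterSplit (T :: w) (S :: u) (S' :: v)

/-- The words whose letters are nonempty subsets of `D`. -/
def subsetWords {E : Type*} (D : Finset E) : Set (List (Finset E)) :=
  {w | ∀ S ∈ w, S.Nonempty ∧ S ⊆ D}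

section Words

variable {E : Type*} {D : Finset E}

theorem nil_mem_subsetWords : [] ∈ subsetWords D := by simp [subsetWords]

theorem cons_mem_subsetWords {S : Finset E} {w : List (Finset E)} :
    S :: w ∈ subsetWords D ↔ (S.Nonempty ∧ S ⊆ D) ∧ w ∈ subsetWords D := by
  simp [subsetWords]

theorem finite_subsetWords (D : Finset E) (n : ℕ) :
    {w | w ∈ subsetWords D ∧ w.length ≤ n}.Finite := by
  refine ((List.finite_length_le (D.powerset) n).image (List.map Subtype.val)).subset ?_
  rintro w ⟨hw, hn⟩
  refine ⟨w.pmap (fun S hS => ⟨S, hS⟩) fun S hS => Finset.mem_powerset.2 (hw S hS).2, ?_, ?_⟩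
  · simpa using hn
  · simp [List.map_pmap]

namespace LetterSplit

theorem length_le {w u v : List (Finset E)} (h : LetterSplit w u v) :
    w.length ≤ u.length + v.length ∧ u.length ≤ w.length ∧ v.length ≤ w.length := by
  induction h with
  | nil => simp
  | left _ ih => simp only [List.length_cons]; omega
  | right _ ih => simp only [List.length_cons]; omega
  | both _ _ _ _ _ ih => simp only [List.length_cons]; omega

/-- A cut letter counts in both `u` and `v`, so this bound on the lengths leaves no room for one. -/
theorem shuffle {w u v : List (Finset E)} (h : LetterSplit w u v) :
    u.length + v.length ≤ w.length → Shuffle u v w := by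
  induction h with
  | nil => exact fun _ => Shuffle.nil
  | left _ ih => exact fun hl => (ih (by simp only [List.length_cons] at hl; omega)).left _
  | right _ ih => exact fun hl => (ih (by simp only [List.length_cons] at hl; omega)).right _
  | both _ _ _ _ h ih =>
    intro hl
    have := h.length_le
    simp only [List.length_cons] at hl
    omega

theorem mem_subsetWords {w u v : List (Finset E)} (h : LetterSplit w u v) :
    w ∈ subsetWords D → u ∈ subsetWords D ∧ v ∈ subsetWords D := by
  induction h with
  | nil => exact fun _ => ⟨nil_mem_subsetWords, nil_mem_subsetWords⟩
  | left _ ih =>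
    intro hw
    rw [cons_mem_subsetWords] at hw ⊢
    exact ⟨⟨hw.1, (ih hw.2).1⟩, (ih hw.2).2⟩
  | right _ ih =>
    intro hw
    rw [cons_mem_subsetWords] at hw ⊢
    exact ⟨(ih hw.2).1, hw.1, (ih hw.2).2⟩
  | both h1 h2 h3 h4 _ ih =>
    intro hw
    rw [cons_mem_subsetWords] at hw
    rw [cons_mem_subsetWords, cons_mem_subsetWords]
    exact ⟨⟨⟨h1, h3.trans hw.1.2⟩, (ih hw.2).1⟩, ⟨h2, h4.trans hw.1.2⟩, (ih hw.2).2⟩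

end LetterSplit

theorem Shuffle.letterSplit {u v w : List (Finset E)} (h : Shuffle u v w) :
    LetterSplit w u v := by
  induction h with
  | nil => exact .nil
  | left x _ ih => exact ih.left
  | right x _ ih => exact ih.right

theorem Shuffle.mem_subsetWords {u v w : List (Finset E)} (h : Shuffle u v w)
    (hu : u ∈ subsetWords D) (hv : v ∈ subsetWords D) : w ∈ subsetWords D := by
  intro S hS
  rcases List.mem_append.1 (h.perm.subset hS) with h | h
  exacts [hu S h, hv S h]

end Words

/-! ### Generic colours along an ultrafilter. -/

theorem Ultrafilter.exists_eventually_eq {ι κ : Type*} [Finite κ] (U : Ultrafilter ι)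
    (h : ι → κ) : ∃ a, ∀ᶠ t in (U : Filter ι), h t = a := by
  obtain ⟨a, ha⟩ := (U.map h).eq_pure_of_finite
  refine ⟨a, ?_⟩
  have : {a} ∈ U.map h := by rw [ha]; exact Ultrafilter.mem_pure.2 rfl
  exact this

section GenericColor

variable {E κ : Type*} [Finite κ]

open Classical in
/-- The colour of the union of `P` with the letters of a word, each moved by a generic map of the
family `e`, later letters being generic with respect to the earlier ones. -/
noncomputable def genericColor (U : Ultrafilter (Finset E)) (e : Finset E → E → E)
    (c : Finset E → κ) : List (Finset E) → Finset E → κ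
  | [] => c
  | S :: w => fun P =>
      (U.exists_eventually_eq fun t => genericColor U e c w (P ∪ S.image (e t))).choose

variable {U : Ultrafilter (Finset E)} {e : Finset E → E → E} {c : Finset E → κ} {D : Finset E}

open Classical in
theorem eventually_genericColor (S : Finset E) (w : List (Finset E)) (P : Finset E) :
    ∀ᶠ t in (U : Filter (Finset E)),
      genericColor U e c w (P ∪ S.image (e t)) = genericColor U e c (S :: w) P :=
  (U.exists_eventually_eq fun t => genericColor U e c w (P ∪ S.image (e t))).choose_spec

/-- Each `t` can be taken to contain all that is already built, so every letter contributes at least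
one new point. This bounds the length of words of nonzero colour. -/
theorem exists_card_le_of_genericColor (hU : (U : Filter (Finset E)) ≤ Filter.atTop)
    (he : ∀ t, ∀ x ∈ D, e t x ∉ t) (w : List (Finset E)) (hw : w ∈ subsetWords D) :
    ∀ P, ∃ R : Finset E, P.card + w.length ≤ R.card ∧ c R = genericColor U e c w P := by
  classical
  induction w with
  | nil => exact fun P => ⟨P, by simp, rfl⟩
  | cons S w ih =>
    intro P
    rw [cons_mem_subsetWords] at hw
    obtain ⟨t, h1, h2⟩ := ((eventually_genericColor (U := U) (e := e) (c := c) S w P).and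
      (hU (Filter.eventually_ge_atTop P))).exists
    obtain ⟨R, hR, hc⟩ := ih hw.2 (P ∪ S.image (e t))
    refine ⟨R, ?_, hc.trans h1⟩
    have hd : Disjoint P (S.image (e t)) := by
      rw [Finset.disjoint_right]
      intro y hy hyP
      obtain ⟨x, hx, rfl⟩ := Finset.mem_image.1 hy
      exact he t x (hw.1.2 hx) (h2 hyP)
    rw [Finset.card_union_of_disjoint hd] at hR
    have : 0 < (S.image (e t)).card := Finset.card_pos.2 (hw.1.1.image _)
    rw [List.length_cons]
    omega

open Classical in
/-- Every word has a realization all of whose parts have the generic colours. -/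
theorem exists_generic_realization (hU : (U : Filter (Finset E)) ≤ Filter.atTop)
    (he : ∀ t, ∀ x ∈ D, e t x ∉ t) (w : List (Finset E)) (hw : w ∈ subsetWords D) :
    ∀ (𝓕 : Finset (Finset E)) (X : Finset E), ∃ Q : Finset E, Disjoint Q X ∧
      (∀ R ⊆ Q, ∃ u v, LetterSplit w u v ∧ ∀ P ∈ 𝓕, c (P ∪ R) = genericColor U e c u P ∧
        c (P ∪ (Q \ R)) = genericColor U e c v P) ∧
      ∀ u v, Shuffle u v w → ∃ R ⊆ Q, ∀ P ∈ 𝓕, c (P ∪ R) = genericColor U e c u P ∧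
        c (P ∪ (Q \ R)) = genericColor U e c v P := by
  induction w with
  | nil =>
    intro 𝓕 X
    refine ⟨∅, by simp, fun R hR => ⟨[], [], .nil, fun P _ => ?_⟩, fun u v h => ?_⟩
    · rw [Finset.subset_empty.1 hR]
      simp [genericColor]
    · cases h
      exact ⟨∅, by simp, fun P _ => by simp [genericColor]⟩
  | cons T w ih =>
    intro 𝓕 X
    rw [cons_mem_subsetWords] at hw
    -- There are finitely many words of bounded length, so one `t` serves all of them, all parts of
    -- `T` and all `P ∈ 𝓕` at once.
    have hfin := finite_subsetWords D w.length
    obtain ⟨t, h1, h2⟩ : ∃ t : Finset E, X ⊆ t ∧ ∀ P ∈ 𝓕, ∀ S ∈ T.powerset,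
        ∀ u ∈ {u | u ∈ subsetWords D ∧ u.length ≤ w.length},
          genericColor U e c u (P ∪ S.image (e t)) = genericColor U e c (S :: u) P := by
      have hX : ∀ᶠ t in (U : Filter (Finset E)), X ⊆ t := hU (Filter.eventually_ge_atTop X)
      refine (hX.and ?_).exists
      refine (Filter.eventually_all_finset 𝓕).2 fun P _ => ?_
      refine (Filter.eventually_all_finset T.powerset).2 fun S _ => ?_
      exact (Filter.eventually_all_finite hfin).2 fun u _ => eventually_genericColor S u P
    -- The tail must be generic over every part of the first copy; the family `𝓕` is carried along
    -- for this purpose.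
    obtain ⟨Q, hQ, h3, h4⟩ := ih hw.2
      ((𝓕 ×ˢ T.powerset).image fun x => x.1 ∪ x.2.image (e t)) (X ∪ T.image (e t))
    rw [Finset.disjoint_union_right] at hQ
    have hmem : ∀ P ∈ 𝓕, ∀ S ⊆ T, P ∪ S.image (e t) ∈
        (𝓕 ×ˢ T.powerset).image fun x => x.1 ∪ x.2.image (e t) := fun P hP S hS =>
      Finset.mem_image.2 ⟨(P, S), Finset.mem_product.2 ⟨hP, Finset.mem_powerset.2 hS⟩, rfl⟩
    refine ⟨T.image (e t) ∪ Q, ?_, ?_, ?_⟩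
    · rw [Finset.disjoint_union_left]
      refine ⟨Finset.disjoint_left.2 fun y hy hyX => ?_, hQ.1⟩
      obtain ⟨x, hx, rfl⟩ := Finset.mem_image.1 hy
      exact he t x (hw.1.2 hx) (h1 hyX)
    · intro R hR
      obtain ⟨u, v, hs, hc⟩ := h3 (R ∩ Q) Finset.inter_subset_right
      obtain ⟨hu, hv⟩ := hs.mem_subsetWords hw.2
      have hlen := hs.length_le
      -- Taking the full preimage of `R` makes the image of `T \ S` avoid `R`, even if `e t` is not
      -- injective.
      set S := T.filter fun x => e t x ∈ R with hS
      have hST : S ⊆ T := Finset.filter_subset _ _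
      have hST' : T \ S ⊆ T := Finset.sdiff_subset
      have hR1 : R = S.image (e t) ∪ (R ∩ Q) := by
        ext y
        have := @hR y
        simp only [Finset.mem_union, Finset.mem_image, Finset.mem_inter, hS,
          Finset.mem_filter] at this ⊢
        constructor
        · intro hy
          rcases this hy with ⟨x, hx, rfl⟩ | hyQ
          · exact Or.inl ⟨x, ⟨hx, hy⟩, rfl⟩
          · exact Or.inr ⟨hy, hyQ⟩
        · rintro (⟨x, ⟨_, hx⟩, rfl⟩ | h)
          exacts [hx, h.1]
      have hR2 : (T.image (e t) ∪ Q) \ R = (T \ S).image (e t) ∪ (Q \ (R ∩ Q)) := by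
        ext y
        simp only [Finset.mem_union, Finset.mem_image, Finset.mem_inter, hS,
          Finset.mem_filter, Finset.mem_sdiff]
        constructor
        · rintro ⟨⟨x, hx, rfl⟩ | hyQ, hy⟩
          · exact Or.inl ⟨x, ⟨hx, fun h => hy h.2⟩, rfl⟩
          · exact Or.inr ⟨hyQ, fun h => hy h.1⟩
        · rintro (⟨x, ⟨hx, hx'⟩, rfl⟩ | ⟨hyQ, hy⟩)
          · exact ⟨Or.inl ⟨x, hx, rfl⟩, fun h => hx' ⟨hx, h⟩⟩
          · exact ⟨Or.inr hyQ, fun h => hy ⟨h, hyQ⟩⟩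
      have c1 : ∀ P ∈ 𝓕, c (P ∪ R) = genericColor U e c u (P ∪ S.image (e t)) := by
        intro P hP
        conv_lhs => rw [hR1, ← Finset.union_assoc]
        exact (hc _ (hmem P hP S hST)).1
      have c2 : ∀ P ∈ 𝓕, c (P ∪ ((T.image (e t) ∪ Q) \ R)) =
          genericColor U e c v (P ∪ (T \ S).image (e t)) := by
        intro P hP
        rw [hR2, ← Finset.union_assoc]
        exact (hc _ (hmem P hP _ hST')).2
      -- The first letter goes wholly to `v`, wholly to `u`, or is cut.
      rcases S.eq_empty_or_nonempty with h0 | h0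
      · refine ⟨u, T :: v, hs.right, fun P hP => ⟨?_, ?_⟩⟩
        · rw [c1 P hP, h0]; simp
        · rw [c2 P hP, h0, Finset.sdiff_empty]
          exact h2 P hP T (by simp) v ⟨hv, hlen.2.2⟩
      rcases (T \ S).eq_empty_or_nonempty with h0' | h0'
      · have hTS : S = T := hST.antisymm (Finset.sdiff_eq_empty_iff_subset.1 h0')
        refine ⟨T :: u, v, hs.left, fun P hP => ⟨?_, ?_⟩⟩
        · rw [c1 P hP, hTS]
          exact h2 P hP T (by simp) u ⟨hu, hlen.2.1⟩
        · rw [c2 P hP, h0']; simp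
      · refine ⟨S :: u, (T \ S) :: v, hs.both h0 h0' hST hST', fun P hP => ⟨?_, ?_⟩⟩
        · rw [c1 P hP]
          exact h2 P hP S (Finset.mem_powerset.2 hST) u ⟨hu, hlen.2.1⟩
        · rw [c2 P hP]
          exact h2 P hP _ (Finset.mem_powerset.2 hST') v ⟨hv, hlen.2.2⟩
    · have hd : Disjoint (T.image (e t)) Q := hQ.2.symm
      intro u v h
      cases h with
      | @left _ u _ _ h =>
        obtain ⟨hu, hv⟩ := h.letterSplit.mem_subsetWords hw.2
        have hlen := h.length_eq
        obtain ⟨R, hR, hc⟩ := h4 _ _ h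
        have hR2 : (T.image (e t) ∪ Q) \ (T.image (e t) ∪ R) = Q \ R := by
          ext y
          have := fun h : y ∈ T.image (e t) => Finset.disjoint_left.1 hd h
          simp only [Finset.mem_sdiff, Finset.mem_union]
          tauto
        refine ⟨T.image (e t) ∪ R, Finset.union_subset_union_right hR, fun P hP => ⟨?_, ?_⟩⟩
        · rw [← Finset.union_assoc, (hc _ (hmem P hP T subset_rfl)).1]
          exact h2 P hP T (by simp) u ⟨hu, by omega⟩
        · rw [hR2]
          simpa using (hc _ (hmem P hP ∅ (by simp))).2
      | @right _ _ v _ h =>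
        obtain ⟨hu, hv⟩ := h.letterSplit.mem_subsetWords hw.2
        have hlen := h.length_eq
        obtain ⟨R, hR, hc⟩ := h4 _ _ h
        have hR2 : (T.image (e t) ∪ Q) \ R = T.image (e t) ∪ (Q \ R) := by
          ext y
          have := fun h : y ∈ T.image (e t) => Finset.disjoint_left.1 hd h
          have := @hR y
          simp only [Finset.mem_sdiff, Finset.mem_union]
          tauto
        refine ⟨R, hR.trans Finset.subset_union_right, fun P hP => ⟨?_, ?_⟩⟩
        · simpa using (hc _ (hmem P hP ∅ (by simp))).1
        · rw [hR2, ← Finset.union_assoc, (hc _ (hmem P hP T subset_rfl)).2]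
          exact h2 P hP T (by simp) v ⟨hv, by omega⟩

end GenericColor

/-! ### Quadrants of the complex plane. -/

/-- The quarter turns of a half-open quadrant cover the punctured plane. Half-openness keeps the
argument of a product of two elements in `[0, π)`. -/
theorem Complex.exists_quadrant {z : ℂ} (hz : z ≠ 0) :
    ∃ k : Fin 4, 0 < (Complex.I ^ (k : ℕ) * z).re ∧ 0 ≤ (Complex.I ^ (k : ℕ) * z).im := by
  have h : z.re ≠ 0 ∨ z.im ≠ 0 := by
    by_contra! h
    exact hz (Complex.ext h.1 h.2)
  have h3 : Complex.I ^ 3 = -Complex.I := Complex.I_pow_three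
  by_cases h0 : 0 < z.re ∧ 0 ≤ z.im
  · exact ⟨0, by simpa using h0⟩
  by_cases h1 : 0 < -z.im ∧ 0 ≤ z.re
  · exact ⟨1, by simpa using h1⟩
  by_cases h2 : 0 < -z.re ∧ 0 ≤ -z.im
  · exact ⟨2, by simpa using h2⟩
  · refine ⟨3, ?_⟩
    simp only [Fin.isValue, Fin.coe_ofNat_eq_mod, Nat.reduceMod, h3]
    simp only [neg_mul, Complex.neg_re, Complex.mul_re, Complex.I_re, Complex.I_im, Complex.neg_im,
      Complex.mul_im]
    grind

open Classical in
/-- The number of quarter turns that bring `z` into the quadrant `0 < re, 0 ≤ im`. -/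
noncomputable def Complex.quadrant (z : ℂ) : Option (Fin 4) :=
  if hz : z = 0 then none else some (Complex.exists_quadrant hz).choose

theorem Complex.quadrant_ne_none {z : ℂ} : z.quadrant ≠ none ↔ z ≠ 0 := by
  unfold Complex.quadrant
  split_ifs with h <;> simp [h]

theorem Complex.quadrant_spec {z : ℂ} {k : Fin 4} (h : z.quadrant = some k) :
    0 < (Complex.I ^ (k : ℕ) * z).re ∧ 0 ≤ (Complex.I ^ (k : ℕ) * z).im := by
  unfold Complex.quadrant at h
  split_ifs at h with hz
  rw [← Option.some_injective _ h]
  exact (Complex.exists_quadrant hz).choose_spec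

/-- Products of numbers from two fixed quadrants do not sum to zero. -/
theorem Complex.sum_ne_zero_of_quadrant {ι : Type*} (s : Finset ι) (x y : ι → ℂ) {i : ι}
    (hi : i ∈ s) (hxi : x i ≠ 0) (hyi : y i ≠ 0)
    (h : ∀ j ∈ s, x j ≠ 0 → y j ≠ 0 →
      (x j).quadrant = (x i).quadrant ∧ (y j).quadrant = (y i).quadrant) :
    ∑ j ∈ s, x j * y j ≠ 0 := by
  obtain ⟨k, hk⟩ := Option.ne_none_iff_exists'.1 (Complex.quadrant_ne_none.2 hxi)
  obtain ⟨l, hl⟩ := Option.ne_none_iff_exists'.1 (Complex.quadrant_ne_none.2 hyi)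
  set F : ι → ℂ := fun j => (Complex.I ^ (k : ℕ) * x j) * (Complex.I ^ (l : ℕ) * y j) with hF
  -- A product of nonzero turned factors lies in the closed upper half-plane and is positive if it
  -- is real.
  have hF' : ∀ j ∈ s, 0 ≤ (F j).im ∧ (x j ≠ 0 → y j ≠ 0 → (F j).im = 0 → 0 < (F j).re) := by
    intro j hj
    by_cases hx : x j = 0
    · simp [hF, hx]
    by_cases hy : y j = 0
    · simp [hF, hy]
    obtain ⟨hx', hy'⟩ := h j hj hx hy
    obtain ⟨a1, a2⟩ := Complex.quadrant_spec (hx'.trans hk)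
    obtain ⟨b1, b2⟩ := Complex.quadrant_spec (hy'.trans hl)
    simp only [hF]
    rw [Complex.mul_im (Complex.I ^ (k : ℕ) * x j), Complex.mul_re (Complex.I ^ (k : ℕ) * x j)]
    generalize Complex.I ^ (k : ℕ) * x j = a at *
    generalize Complex.I ^ (l : ℕ) * y j = b at *
    refine ⟨by positivity, fun _ _ h0 => ?_⟩
    have e1 : 0 ≤ a.re * b.im := by positivity
    have e2 : 0 ≤ a.im * b.re := by positivity
    have e3 : a.im = 0 := by
      have : a.im * b.re = 0 := by linarith
      exact (mul_eq_zero.1 this).resolve_right b1.ne'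
    rw [e3, zero_mul, sub_zero]
    positivity
  intro h0
  have hsum : ∑ j ∈ s, F j = 0 := by
    have : ∀ j, F j = (Complex.I ^ (k : ℕ) * Complex.I ^ (l : ℕ)) * (x j * y j) := fun j => by
      simp only [hF]; ring
    simp only [this]
    rw [← Finset.mul_sum, h0, mul_zero]
  have him : ∑ j ∈ s, (F j).im = 0 := by rw [← Complex.im_sum, hsum, Complex.zero_im]
  have hre : ∑ j ∈ s, (F j).re = 0 := by rw [← Complex.re_sum, hsum, Complex.zero_re]
  have him0 := (Finset.sum_eq_zero_iff_of_nonneg fun j hj => (hF' j hj).1).1 him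
  have hre0 : ∀ j ∈ s, 0 ≤ (F j).re := by
    intro j hj
    by_cases hx : x j = 0
    · simp [hF, hx]
    by_cases hy : y j = 0
    · simp [hF, hy]
    exact ((hF' j hj).2 hx hy (him0 j hj)).le
  exact absurd ((Finset.sum_eq_zero_iff_of_nonneg hre0).1 hre i hi)
    ((hF' i hi).2 hxi hyi (him0 i hi)).ne'

/-! ### Nonvanishing of products. -/

open Classical in
/-- Two maps of bounded degree have a nonzero product as soon as both are nonzero on parts of
images of a finite set `D` that avoid any given finite set. -/
theorem FinsetMap.mul_ne_zero_of_copies {E : Type*} (f g : FinsetMap ℂ E) {M N : ℕ}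
    (hM : ∀ P : Finset E, M ≤ P.card → f P = 0) (hN : ∀ P : Finset E, N ≤ P.card → g P = 0)
    (D : Finset E) {A B : Finset E} (hA : A ⊆ D) (hB : B ⊆ D) (e : Finset E → E → E)
    (he : ∀ t, ∀ x ∈ D, e t x ∉ t) (hf : ∀ t, f (A.image (e t)) ≠ 0)
    (hg : ∀ t, g (B.image (e t)) ≠ 0) : f * g ≠ 0 := by
  obtain ⟨U, hU⟩ : ∃ U : Ultrafilter (Finset E), (U : Filter (Finset E)) ≤ Filter.atTop :=
    ⟨Ultrafilter.of Filter.atTop, Ultrafilter.of_le _⟩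
  -- For either factor, the longest words of nonzero generic colour form a finite nonempty set.
  have longest : ∀ (f : FinsetMap ℂ E) (M : ℕ), (∀ P : Finset E, M ≤ P.card → f P = 0) →
      ∀ A ⊆ D, (∀ t, f (A.image (e t)) ≠ 0) → ∀ (c : Finset E → Option (Fin 4) × Option (Fin 4))
      (π : Option (Fin 4) × Option (Fin 4) → Option (Fin 4)),
      (∀ P, π (c P) = (f P).quadrant) → ∃ p, ∃ s : Set (List (Finset E)), s.Finite ∧
        s.Nonempty ∧ (∀ u ∈ s, u.length = p ∧ u ∈ subsetWords D ∧
          π (genericColor U e c u ∅) ≠ none) ∧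
        (∀ u ∈ subsetWords D, π (genericColor U e c u ∅) ≠ none → u.length ≤ p) ∧
        ∀ u ∈ subsetWords D, π (genericColor U e c u ∅) ≠ none → u.length = p → u ∈ s := by
    intro f M hM A hA hf c π hc
    set W := {u | u ∈ subsetWords D ∧ π (genericColor U e c u ∅) ≠ none} with hW
    have hfin : W.Finite := by
      refine (finite_subsetWords D M).subset fun u hu => ⟨hu.1, ?_⟩
      obtain ⟨R, hR, hcR⟩ := exists_card_le_of_genericColor (c := c) hU he u hu.1 ∅
      have h := hu.2
      rw [← hcR, hc, Complex.quadrant_ne_none] at h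
      by_contra hlt
      exact h (hM R (by rw [Finset.card_empty] at hR; omega))
    have hne : W.Nonempty := by
      -- The empty set is not a letter; the empty word stands for it.
      rcases A.eq_empty_or_nonempty with rfl | hA0
      · refine ⟨[], nil_mem_subsetWords, ?_⟩
        rw [genericColor, hc, Complex.quadrant_ne_none]
        simpa using hf ∅
      · refine ⟨[A], by simpa [subsetWords] using ⟨hA0, hA⟩, ?_⟩
        obtain ⟨t, ht⟩ := (eventually_genericColor (U := U) (e := e) (c := c) A [] ∅).exists
        rw [← ht, genericColor, hc, Complex.quadrant_ne_none]
        simpa using hf t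
    obtain ⟨u, hu, hmax⟩ := Set.exists_max_image W List.length hfin hne
    exact ⟨u.length, {v ∈ W | v.length = u.length}, hfin.subset fun v hv => hv.1,
      ⟨u, hu, rfl⟩, fun v hv => ⟨hv.2, hv.1.1, hv.1.2⟩, fun v h1 h2 => hmax v ⟨h1, h2⟩,
      fun v h1 h2 h3 => ⟨⟨h1, h2⟩, h3⟩⟩
  -- One colour records both factors, so that a single `Q` is generic for both.
  set c : Finset E → Option (Fin 4) × Option (Fin 4) :=
    fun P => ((f P).quadrant, (g P).quadrant) with hc
  obtain ⟨p, s, hs, hs0, hsp, hsl, hsm⟩ := longest f M hM A hA hf c Prod.fst fun _ => rfl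
  obtain ⟨q, s', hs', hs0', hsq, hsl', hsm'⟩ := longest g N hN B hB hg c Prod.snd fun _ => rfl
  obtain ⟨u, hu, v, hv, w, hw, huniq⟩ := Shuffle.exists_unique_pair hs hs' hs0 hs0'
    (fun u hu => (hsp u hu).1) (fun v hv => (hsq v hv).1)
  have hwD := hw.mem_subsetWords (hsp u hu).2.1 (hsq v hv).2.1
  obtain ⟨Q, -, h1, h2⟩ := exists_generic_realization (c := c) hU he w hwD {∅} ∅
  obtain ⟨R, hR, hRc⟩ := h2 u v hw
  obtain ⟨hR1, hR2⟩ := hRc ∅ (by simp)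
  rw [Finset.empty_union] at hR1 hR2
  have hfR : f R ≠ 0 := by
    rw [← Complex.quadrant_ne_none]
    exact (congrArg Prod.fst hR1).trans_ne (hsp u hu).2.2
  have hgR : g (Q \ R) ≠ 0 := by
    rw [← Complex.quadrant_ne_none]
    exact (congrArg Prod.snd hR2).trans_ne (hsq v hv).2.2
  intro h0
  have hQ : (f * g) Q = 0 := by rw [h0]; rfl
  rw [FinsetMap.mul_apply] at hQ
  refine Complex.sum_ne_zero_of_quadrant Q.powerset f (fun P => g (Q \ P))
    (Finset.mem_powerset.2 hR) hfR ?_ ?_ (by convert hQ)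
  · convert hgR
  intro P hP hfP hgP
  obtain ⟨u', v', hsplit, hPc⟩ := h1 P (Finset.mem_powerset.1 hP)
  obtain ⟨hP1, hP2⟩ := hPc ∅ (by simp)
  rw [Finset.empty_union] at hP1 hP2
  have hu' : (genericColor U e c u' ∅).1 ≠ none := by
    rw [← hP1]; exact Complex.quadrant_ne_none.2 hfP
  have hv' : (genericColor U e c v' ∅).2 ≠ none := by
    rw [← hP2]
    refine Complex.quadrant_ne_none.2 ?_
    convert hgP
  obtain ⟨huD, hvD⟩ := hsplit.mem_subsetWords hwD
  -- `p + q = w.length ≤ u'.length + v'.length ≤ p + q`, so both words have maximal length and no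
  -- letter of `w` is cut.
  have l1 := hsl u' huD hu'
  have l2 := hsl' v' hvD hv'
  have l3 := hsplit.length_le.1
  have l4 := hw.length_eq
  have l5 := (hsp u hu).1
  have l6 := (hsq v hv).1
  obtain ⟨rfl, rfl⟩ := huniq u' (hsm u' huD hu' (by omega)) v' (hsm' v' hvD hv' (by omega))
    (hsplit.shuffle (by omega))
  refine ⟨congrArg Prod.fst (hP1.trans hR1.symm), ?_⟩
  have := congrArg Prod.snd (hP2.trans hR2.symm)
  convert this

/-! ### Kernel, disjoint copies and the age algebra. -/

namespace FirstOrder.Language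

variable {L : Language} [L.IsRelational] {E : Type*} [L.Structure E]

theorem RestrictIso.refl (P : Finset E) : L.RestrictIso P P := ⟨Equiv.refl L _⟩

theorem RestrictIso.symm {P P' : Finset E} (h : L.RestrictIso P P') : L.RestrictIso P' P :=
  ⟨h.some.symm⟩

theorem RestrictIso.trans {P P' P'' : Finset E} (h : L.RestrictIso P P')
    (h' : L.RestrictIso P' P'') : L.RestrictIso P P'' :=
  ⟨h'.some.comp h.some⟩

theorem Embedding.exists_finset_equiv {N : Type*} [L.Structure N] [Finite N] (φ : N ↪[L] E) :
    ∃ F : Finset E, (F : Set E) = Set.range φ ∧ Nonempty (N ≃[L] L.restrict (F : Set E)) := by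
  have hfin : (Set.range φ).Finite := Set.finite_range φ
  refine ⟨hfin.toFinset, hfin.coe_toFinset, ?_⟩
  have h : φ.toHom.range = L.restrict (hfin.toFinset : Set E) := by
    apply SetLike.coe_injective
    rw [hfin.coe_toFinset]
    exact Hom.range_coe _
  rw [← h]
  exact ⟨φ.equivRange⟩

theorem exists_finset_equiv_of_mem_age {N : CategoryTheory.Bundled L.Structure}
    (hN : N ∈ L.age E) : ∃ F : Finset E, Nonempty (N ≃[L] L.restrict (F : Set E)) := by
  obtain ⟨hfg, ⟨φ⟩⟩ := hN
  have := hfg.finite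
  obtain ⟨F, -, h⟩ := φ.exists_finset_equiv
  exact ⟨F, h⟩

theorem restrict_finset_fg (F : Finset E) : Structure.FG L (L.restrict (F : Set E)) :=
  have : Finite (L.restrict (F : Set E)) := F.finite_toSet
  Structure.FG.of_finite

/-- The age of a substructure is always contained in the whole age, so only the other inclusion
matters: every finite restriction can be moved off `x`. -/
theorem kernel_eq_empty_iff : L.kernel E = ∅ ↔
    ∀ (x : E) (F : Finset E), ∃ F' : Finset E, L.RestrictIso F F' ∧ x ∉ F' := by
  rw [Set.eq_empty_iff_forall_notMem]
  refine forall_congr' fun x => ?_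
  change ¬ (L.age (L.restrict ({x}ᶜ : Set E)) ≠ L.age E) ↔ _
  rw [not_not]
  constructor
  · intro h F
    have hF : CategoryTheory.Bundled.mk (L.restrict (F : Set E)) ∈ L.age E :=
      ⟨restrict_finset_fg F, ⟨Substructure.subtype _⟩⟩
    rw [← h] at hF
    obtain ⟨-, ⟨φ⟩⟩ := hF
    have : Finite (L.restrict (F : Set E)) := F.finite_toSet
    obtain ⟨F', hF', hiso⟩ :=
      ((L.restrict ({x}ᶜ : Set E)).subtype.comp φ).exists_finset_equiv
    refine ⟨F', hiso, fun hx => ?_⟩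
    have hx' : x ∈ (F' : Set E) := hx
    rw [hF'] at hx'
    obtain ⟨y, hy⟩ := hx'
    exact (φ y).2 hy
  · intro h
    refine subset_antisymm (Embedding.age_subset_age (Substructure.subtype _)) fun N hN => ?_
    obtain ⟨F, ⟨i⟩⟩ := exists_finset_equiv_of_mem_age hN
    obtain ⟨F', ⟨j⟩, hx⟩ := h F
    have hle : L.restrict (F' : Set E) ≤ L.restrict ({x}ᶜ : Set E) := fun y hy hyx => by
      rw [Set.mem_singleton_iff] at hyx
      exact hx (hyx ▸ hy)
    exact ⟨hN.1, ⟨(Substructure.inclusion hle).comp (j.comp i).toEmbedding⟩⟩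

/-- If the kernel is empty, every finite restriction `F` has, inside a suitable finite set, copies
that cannot all be met by `k` points. -/
theorem exists_copies_not_met (h : L.kernel E = ∅) (F : Finset E) (k : ℕ) :
    ∃ S : Finset E, ∀ Y : Finset E, Y.card ≤ k →
      ∃ F' ⊆ S, L.RestrictIso F F' ∧ Disjoint F' Y := by
  classical
  rw [kernel_eq_empty_iff] at h
  induction k with
  | zero =>
    refine ⟨F, fun Y hY => ⟨F, subset_rfl, .refl F, ?_⟩⟩
    rw [Finset.card_eq_zero.1 (Nat.le_zero.1 hY)]
    exact Finset.disjoint_empty_right F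
  | succ k ih =>
    obtain ⟨S, hS⟩ := ih
    -- `c x` is a copy of all of `S` that avoids `x`.
    choose c hc hxc using fun x => h x S
    refine ⟨S ∪ S.biUnion c, fun Y hY => ?_⟩
    by_cases hYS : Disjoint S Y
    · obtain ⟨F', h1, h2, -⟩ := hS ∅ (by simp)
      exact ⟨F', h1.trans Finset.subset_union_left, h2, hYS.mono_left h1⟩
    -- Since `c x` misses the point `x` of `Y`, at most `k` points of `Y` can meet it; transporting
    -- them back to `S` permits induction.
    · obtain ⟨x, hxS, hxY⟩ := Finset.not_disjoint_iff.1 hYS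
      obtain ⟨φ, ψ, hφ, hψ, hiso⟩ := (hc x).exists_map
      obtain ⟨F', h1, h2, h3⟩ := hS ((Y.erase x).image ψ)
        (Finset.card_image_le.trans (by rw [Finset.card_erase_of_mem hxY]; omega))
      have hsub : F'.image φ ⊆ c x :=
        Finset.image_subset_iff.2 fun y hy => (hφ y (h1 hy)).1
      refine ⟨F'.image φ, hsub.trans ((Finset.subset_biUnion_of_mem c hxS).trans
        Finset.subset_union_right), h2.trans (hiso F' h1), ?_⟩
      rw [Finset.disjoint_left]
      intro z hz hzY
      have hzx : z ≠ x := fun e => hxc x (e ▸ hsub hz)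
      obtain ⟨y, hy, rfl⟩ := Finset.mem_image.1 hz
      refine Finset.disjoint_left.1 h3 hy (Finset.mem_image.2
        ⟨φ y, Finset.mem_erase.2 ⟨hzx, hzY⟩, (hφ y (h1 hy)).2⟩)

theorem exists_copy_disjoint (h : L.kernel E = ∅) (F T : Finset E) :
    ∃ F', L.RestrictIso F F' ∧ Disjoint F' T := by
  obtain ⟨S, hS⟩ := exists_copies_not_met h F T.card
  obtain ⟨F', -, h1, h2⟩ := hS T le_rfl
  exact ⟨F', h1, h2⟩

theorem isDomain_ageAlgebra (h : L.kernel E = ∅) : IsDomain (L.ageAlgebra E ℂ) := by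
  classical
  have hnt : Nontrivial (L.ageAlgebra E ℂ) := by
    refine ⟨0, 1, fun h01 => ?_⟩
    have h2 : (0 : FinsetMap ℂ E) ∅ = (1 : FinsetMap ℂ E) ∅ :=
      congrArg (fun f : L.ageAlgebra E ℂ => (f : FinsetMap ℂ E) ∅) h01
    rw [FinsetMap.one_apply, if_pos rfl] at h2
    exact zero_ne_one h2
  have hnzd : NoZeroDivisors (L.ageAlgebra E ℂ) := by
    refine ⟨fun {f g} hfg => ?_⟩
    by_contra! hne
    obtain ⟨⟨f, hf, M, hM⟩, ⟨g, hg, N, hN⟩⟩ := f, g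
    obtain ⟨A, hA⟩ : ∃ A, f A ≠ 0 := by
      by_contra! h0
      exact hne.1 (Subtype.ext (FinsetMap.ext h0))
    obtain ⟨B, hB⟩ : ∃ B, g B ≠ 0 := by
      by_contra! h0
      exact hne.2 (Subtype.ext (FinsetMap.ext h0))
    have hcopy : ∀ T : Finset E, ∃ e : E → E, (∀ x ∈ A ∪ B, e x ∉ T) ∧
        ∀ S ⊆ A ∪ B, L.RestrictIso S (S.image e) := by
      intro T
      obtain ⟨F, hF, hd⟩ := exists_copy_disjoint h (A ∪ B) T
      obtain ⟨φ, ψ, h1, -, h3⟩ := hF.exists_map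
      exact ⟨φ, fun x hx => Finset.disjoint_left.1 hd (h1 x hx).1, h3⟩
    choose e he hiso using hcopy
    refine FinsetMap.mul_ne_zero_of_copies f g hM hN (A ∪ B) Finset.subset_union_left
      Finset.subset_union_right e he (fun t => ?_) (fun t => ?_) (congrArg Subtype.val hfg)
    · have := hf _ _ (hiso t A Finset.subset_union_left)
      rw [this] at hA
      convert hA
    · have := hg _ _ (hiso t B Finset.subset_union_right)
      rw [this] at hB
      convert hB
  exact NoZeroDivisors.to_isDomain _

theorem kernel_eq_empty_of_isDomain (h : IsDomain (L.ageAlgebra E ℂ)) : L.kernel E = ∅ := by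
  classical
  rw [kernel_eq_empty_iff]
  by_contra! hx
  obtain ⟨x, F, hF⟩ := hx
  let f : FinsetMap ℂ E := fun P => if L.RestrictIso F P then 1 else 0
  have hfP : ∀ P, f P = if L.RestrictIso F P then 1 else 0 := fun _ => rfl
  have hmem : f ∈ L.ageAlgebra E ℂ := by
    refine ⟨fun P P' hP => ?_, F.card + 1, fun P hP => if_neg fun hFP => ?_⟩
    · have : L.RestrictIso F P ↔ L.RestrictIso F P' := ⟨fun h => h.trans hP, fun h => h.trans hP.symm⟩
      simp only [hfP, this]
    · have := hFP.card_eq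
      omega
  have hsq : (⟨f, hmem⟩ : L.ageAlgebra E ℂ) * ⟨f, hmem⟩ = 0 := by
    refine Subtype.ext (FinsetMap.ext fun Q => ?_)
    change (f * f) Q = 0
    rw [FinsetMap.mul_apply]
    refine Finset.sum_eq_zero fun P _ => ?_
    by_cases h1 : L.RestrictIso F P
    -- `P` and its complement in `Q` cannot both contain `x`.
    · have h2 : ¬ L.RestrictIso F (Q \ P) := fun h2 =>
        (Finset.mem_sdiff.1 (hF _ h2)).2 (hF _ h1)
      rw [hfP (Q \ P), if_neg h2, mul_zero]
    · rw [hfP P, if_neg h1, zero_mul]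
  have h0 : f = 0 := congrArg Subtype.val (mul_self_eq_zero.1 hsq)
  have h1 : f F = 1 := if_pos (.refl F)
  rw [h0] at h1
  exact zero_ne_one h1

theorem ageInexhaustible_of_kernel_eq_empty (h : L.kernel E = ∅) : L.AgeInexhaustible E := by
  classical
  intro A hA B hB
  obtain ⟨F, ⟨i⟩⟩ := exists_finset_equiv_of_mem_age hA
  obtain ⟨G, ⟨j⟩⟩ := exists_finset_equiv_of_mem_age hB
  obtain ⟨G', ⟨k⟩, hd⟩ := exists_copy_disjoint h G F
  have h1 : L.restrict (F : Set E) ≤ L.restrict ((F ∪ G' : Finset E) : Set E) :=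
    fun x hx => Finset.mem_union_left _ hx
  have h2 : L.restrict (G' : Set E) ≤ L.restrict ((F ∪ G' : Finset E) : Set E) :=
    fun x hx => Finset.mem_union_right _ hx
  refine ⟨CategoryTheory.Bundled.mk (L.restrict ((F ∪ G' : Finset E) : Set E)),
    ⟨restrict_finset_fg _, ⟨Substructure.subtype _⟩⟩,
    (Substructure.inclusion h1).comp i.toEmbedding,
    (Substructure.inclusion h2).comp (k.comp j).toEmbedding, ?_⟩
  rw [Set.disjoint_left]
  rintro _ ⟨a, rfl⟩ ⟨b, hb⟩
  have hab : ((k (j b) : E)) = (i a : E) := congrArg Subtype.val hb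
  exact Finset.disjoint_left.1 hd (k (j b)).2 (hab ▸ (i a).2)

/-- Applied to `F` twice, inexhaustibility gives two disjoint copies of `F`, at most one of which
contains `x`. -/
theorem kernel_eq_empty_of_ageInexhaustible (h : L.AgeInexhaustible E) : L.kernel E = ∅ := by
  rw [kernel_eq_empty_iff]
  intro x F
  have hF : CategoryTheory.Bundled.mk (L.restrict (F : Set E)) ∈ L.age E :=
    ⟨restrict_finset_fg F, ⟨Substructure.subtype _⟩⟩
  have : Finite (L.restrict (F : Set E)) := F.finite_toSet
  obtain ⟨C, ⟨-, ⟨φ⟩⟩, f, g, hd⟩ := h _ hF _ hF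
  obtain ⟨F₁, h1, i1⟩ := (φ.comp f).exists_finset_equiv
  obtain ⟨F₂, h2, i2⟩ := (φ.comp g).exists_finset_equiv
  by_cases hx1 : x ∈ F₁
  · refine ⟨F₂, i2, fun hx2 => ?_⟩
    rw [← Finset.mem_coe, h1] at hx1
    rw [← Finset.mem_coe, h2] at hx2
    obtain ⟨a, ha⟩ := hx1
    obtain ⟨b, hb⟩ := hx2
    have hab : f a = g b := φ.injective (ha.trans hb.symm)
    exact Set.disjoint_left.1 hd ⟨a, rfl⟩ ⟨b, hab.symm⟩
  · exact ⟨F₁, i1, hx1⟩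

end FirstOrder.Language

theorem theorem1 (L : FirstOrder.Language) [L.IsRelational] (E : Type*) [L.Structure E] :
    (IsDomain (L.ageAlgebra E ℂ) ↔ L.kernel E = ∅) ∧
      (L.kernel E = ∅ ↔ L.AgeInexhaustible E) :=
  ⟨⟨FirstOrder.Language.kernel_eq_empty_of_isDomain, FirstOrder.Language.isDomain_ageAlgebra⟩,
    FirstOrder.Language.ageInexhaustible_of_kernel_eq_empty,
    FirstOrder.Language.kernel_eq_empty_of_ageInexhaustible⟩
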